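/- **Dilatation structures.** Let $(X,d)$ be a complete metric space whose closed balls $\bar B(x,3)$, $x\in X$, are all compact. A *dilatation structure* $(X,d,\delta)$ assigns to every $x\in X$ and $\varepsilon\in(0,\infty)$ a homeomorphism $\delta^x_\varepsilon$ between subsets of $X$, namely $\delta^x_\varepsilon:U(x)\to V_\varepsilon(x)$ if $\varepsilon\le 1$ and $\delta^x_\varepsilon:W_\varepsilon(x)\to U(x)$ if $\varepsilon>1$, such that the following hold. (A0) There are numbers $1<A<B$ such that for all $x\in X$ one has $\bar B(x,A)\subset U(x)$, and for all $\varepsilon\in(0,1)$ $$B(x,\varepsilon)\subset\delta^x_\varepsilon B(x,A)\subset V_\varepsilon(x)\subset W_{\varepsilon^{-1}}(x)\subset\delta^x_\varepsilon\bigl(B(x,B)\cap U(x)\bigr).$$ For every compact $K\subset X$ there are $R>0$ and $\varepsilon_0\in(0,1)$ such that $\delta^x_\varepsilon v\in W_{\varepsilon^{-1}}(\delta^x_\varepsilon u)$ for all $x\in K$, $u,v\in\bar B(x,R)$, $\varepsilon\in(0,\varepsilon_0)$. (A1) $\delta^x_\varepsilon x=x$, and $\delta^x_1=\mathrm{id}$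 on $U(x)$. Let $\operatorname{dom}\delta$ be the set of $(\varepsilon,x,y)\in(0,\infty)\times X\times X$ with $y\in U(x)$ if $\varepsilon\le1$ and $y\in W_\varepsilon(x)$ if $\varepsilon>1$. The map $(\varepsilon,x,y)\mapsto\delta^x_\varepsilon y$ is continuous on $\operatorname{dom}\delta$ and extends continuously to the closure of $\operatorname{dom}\delta$ in $[0,\infty)\times X\times X$; moreover $\lim_{\varepsilon\to0}\delta^x_\varepsilon y=x$ for $y\in U(x)$. (A2) $\delta^x_\varepsilon\delta^x_\mu u=\delta^x_{\varepsilon\mu}u$ for $u\in U(x)$ and $\varepsilon,\mu>0$ whenever both sides are defined. (A3) For every $x$ there is a distance function $d^x$ on $\bar B(x,A)$ such that $$\lim_{\varepsilon\to0}\ \sup\Bigl\{\bigl|\tfrac1\varepsilon d(\delta^x_\varepsilon u,\delta^x_\varepsilon v)-d^x(u,v)\bigr| : u,v\in\bar B(x,A)\Bigr\}=0$$ uniformly with respect to $x$ in compact sets. The structure is *strong* if moreover (A4) the limit $\Delta^x(u,v)=\lim_{\varepsilon\to0}\delta^{\delta^x_\varepsilon u}_{\varepsilon^{-1}}\delta^x_\varepsilon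 v$ exists, in the sense that for every compact $K\subset X$ there is $R>0$ such that the convergence is uniform over $x\in K$ and $u,v\in\bar B(x,R)$. **Derivatives of curves.** Let $x\in X$. The tangent space $T_xX$ is the local group around $x$ with operation $\Sigma^x(u,v)=\lim_{\varepsilon\to0}\delta^x_{\varepsilon^{-1}}\delta^{\delta^x_\varepsilon u}_\varepsilon v$, equipped with the dilatations $\delta^x_\varepsilon$. A *conical group morphism* $f:\mathbb R\to T_xX$ is a map $f:(-r,r)\to\bar B(x,A)$, for some $r>0$, with $\Sigma^x(f(s),f(t))=f(s+t)$ and $f(\varepsilon s)=\delta^x_\varepsilon f(s)$ for $\varepsilon>0$, whenever all arguments of $f$ lie in $(-r,r)$. A curve $c$ is *derivable* at an interior point $t$ of its interval if there is such a morphism $f$ into $T_{c(t)}X$ with $$\lim_{\varepsilon\to0^+}\frac1\varepsilon\, d\bigl(c(t+\varepsilon s),\delta^{c(t)}_\varepsilon f(s)\bigr)=0\qquad\text{for all } s\in(-r,r).$$ Its velocity is $\dot c(t)=f(1)$, where for $r\le1$ the vector $f(1)$ is understood in the tangent cone obtained by extending dilatations; by homogeneity of $d^{c(t)}$ one puts,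 in all cases, $d^{c(t)}(c(t),\dot c(t))=\frac1s\,d^{c(t)}(c(t),f(s))$ for $s\in(0,r)$. The structure has the *Radon–Nikodym property* if every Lipschitz curve $c:[a,b]\to X$ is derivable at almost every $t\in[a,b]$. **Length metric spaces.** $(X,d)$ is a *length metric space* if any two points are joined by a Lipschitz curve and $d(x,y)$ is the infimum of the lengths (variations) of the Lipschitz curves joining $x$ to $y$. **Theorem.** Let $(X,d,\delta)$ be a strong dilatation structure with the Radon–Nikodym property, over a complete length metric space $(X,d)$. Then for every Lipschitz curve $c:[a,b]\to X$ the function $t\mapsto d^{c(t)}(c(t),\dot c(t))$ (defined almost everywhere) is integrable on $[a,b]$, and for any $x,y\in X$ $$d(x,y)=\inf\Bigl\{\int_a^b d^{c(t)}(c(t),\dot c(t))\,dt \;:\; c:[a,b]\to X \text{ Lipschitz},\ c(a)=x,\ c(b)=y\Bigr\}.$$ -/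

import Mathlib

open Set Filter Topology MeasureTheory Metric
open scoped NNReal ENNReal

/-- `f` restricts to a homeomorphism from the subset `S` onto the subset `T`. -/
def IsHomeoOn {X : Type*} [TopologicalSpace X] (f : X → X) (S T : Set X) : Prop :=
  f '' S = T ∧ IsEmbedding (S.domRestrict f)

/-- `c`, restricted to `[a, b]`, is a Lipschitz curve. -/
def IsLipCurve {X : Type*} [MetricSpace X] (c : ℝ → X) (a b : ℝ) : Prop :=
  ∃ K : ℝ≥0, LipschitzOnWith K c (Icc a b)

/-- A length metric space: the distance between two points is the infimum of the lengths
(variations) of the Lipschitz curves joining them. Since the distance is finite, this contains the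
requirement that any two points are joined by a Lipschitz curve (of finite length). -/
def IsLengthMetricSpace (X : Type*) [MetricSpace X] : Prop :=
  ∀ x y : X, IsGLB {l : ℝ≥0∞ | ∃ (a b : ℝ) (c : ℝ → X), a ≤ b ∧ IsLipCurve c a b ∧
    c a = x ∧ c b = y ∧ l = eVariationOn c (Icc a b)} (edist x y)

/-- The domain of a family of dilatations: the dilatation of coefficient `ε` based at `x` is
defined on `U x` if `ε ≤ 1`, and on `W ε x` if `ε > 1`. -/
def dilDom {X : Type*} (U : X → Set X) (W : ℝ → X → Set X) : Set (ℝ × X × X) :=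
  {p | 0 < p.1 ∧ (p.1 ≤ 1 → p.2.2 ∈ U p.2.1) ∧ (1 < p.1 → p.2.2 ∈ W p.1 p.2.1)}

/-- A dilatation structure over a metric space `X`. The value `δ ε x y` is the dilatation of
coefficient `ε > 0` based at `x`, applied to `y`; it is meaningful only for `(ε, x, y)` in
`dilDom U W`. The value `dx x u v` is the tangent distance `d^x (u, v)`; it is
meaningful only for `u`, `v` in the closed ball `B(x, A)`, where it is determined by the other
data through the axiom `A3_lim`. -/
structure DilatationStructure (X : Type*) [MetricSpace X] where
  U : X → Set X
  V : ℝ → X → Set X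
  W : ℝ → X → Set X
  δ : ℝ → X → X → X
  A : ℝ
  B : ℝ
  dx : X → X → X → ℝ
  isCompact_closedBall : ∀ x : X, IsCompact (closedBall x 3)
  homeo_le_one : ∀ (x : X) (ε : ℝ), 0 < ε → ε ≤ 1 → IsHomeoOn (δ ε x) (U x) (V ε x)
  homeo_one_lt : ∀ (x : X) (ε : ℝ), 1 < ε → IsHomeoOn (δ ε x) (W ε x) (U x)
  /- Axiom A0 -/
  one_lt_A : 1 < A
  A_lt_B : A < B
  closedBall_subset_U : ∀ x : X, closedBall x A ⊆ U x
  A0_ball : ∀ (x : X) (ε : ℝ), 0 < ε → ε < 1 → ball x ε ⊆ δ ε x '' ball x A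
  A0_V : ∀ (x : X) (ε : ℝ), 0 < ε → ε < 1 → δ ε x '' ball x A ⊆ V ε x
  A0_VW : ∀ (x : X) (ε : ℝ), 0 < ε → ε < 1 → V ε x ⊆ W ε⁻¹ x
  A0_W : ∀ (x : X) (ε : ℝ), 0 < ε → ε < 1 → W ε⁻¹ x ⊆ δ ε x '' (ball x B ∩ U x)
  A0_compact : ∀ K : Set X, IsCompact K → ∃ R > 0, ∃ ε₀ ∈ Ioo (0 : ℝ) 1,
    ∀ x ∈ K, ∀ u ∈ closedBall x R, ∀ v ∈ closedBall x R, ∀ ε ∈ Ioo 0 ε₀,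
      δ ε x v ∈ W ε⁻¹ (δ ε x u)
  /- Axiom A1 -/
  A1_base : ∀ (x : X) (ε : ℝ), 0 < ε → δ ε x x = x
  A1_one : ∀ x : X, ∀ u ∈ U x, δ 1 x u = u
  A1_continuous : ∃ g : ℝ × X × X → X, ContinuousOn g (closure (dilDom U W)) ∧
    ∀ p ∈ dilDom U W, g p = δ p.1 p.2.1 p.2.2
  A1_lim : ∀ x : X, ∀ u ∈ U x, Tendsto (fun ε => δ ε x u) (𝓝[>] 0) (𝓝 x)
  /- Axiom A2 -/
  A2 : ∀ (x : X) (ε μ : ℝ), ∀ u ∈ U x, (μ, x, u) ∈ dilDom U W → (ε, x, δ μ x u) ∈ dilDom U W →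
    (ε * μ, x, u) ∈ dilDom U W → δ ε x (δ μ x u) = δ (ε * μ) x u
  /- Axiom A3: `dx x` is a distance on the closed ball `B(x, A)`, and the limit of the rescaled
  distances -/
  dx_eq_zero : ∀ x : X, ∀ u ∈ closedBall x A, ∀ v ∈ closedBall x A, dx x u v = 0 ↔ u = v
  dx_comm : ∀ x : X, ∀ u ∈ closedBall x A, ∀ v ∈ closedBall x A, dx x u v = dx x v u
  dx_triangle : ∀ x : X, ∀ u ∈ closedBall x A, ∀ v ∈ closedBall x A, ∀ w ∈ closedBall x A,
    dx x u w ≤ dx x u v + dx x v w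
  A3_lim : ∀ K : Set X, IsCompact K → ∀ η > 0, ∃ ε₀ > 0, ∀ ε ∈ Ioo (0 : ℝ) ε₀, ∀ x ∈ K,
    ∀ u ∈ closedBall x A, ∀ v ∈ closedBall x A,
      |ε⁻¹ * dist (δ ε x u) (δ ε x v) - dx x u v| ≤ η

namespace DilatationStructure

variable {X : Type*} [MetricSpace X] (D : DilatationStructure X)

/-- The approximate difference `Δ_ε^x (u, v)`. -/
noncomputable def approxDiff (ε : ℝ) (x u v : X) : X := D.δ ε⁻¹ (D.δ ε x u) (D.δ ε x v)

/-- The approximate sum `Σ_ε^x (u, v)`. -/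
noncomputable def approxSum (ε : ℝ) (x u v : X) : X := D.δ ε⁻¹ x (D.δ ε (D.δ ε x u) v)

/-- Axiom A4: the approximate differences converge as `ε → 0`, uniformly with respect to `x` in a
compact set and to `u`, `v` in a closed ball around `x` on which they are defined. -/
def IsStrong : Prop :=
  ∃ Δ : X → X → X → X, ∀ K : Set X, IsCompact K → ∃ R > 0,
    TendstoUniformlyOn (fun (ε : ℝ) (p : X × X × X) => D.approxDiff ε p.1 p.2.1 p.2.2)
      (fun p => Δ p.1 p.2.1 p.2.2) (𝓝[>] 0)
      {p | p.1 ∈ K ∧ p.2.1 ∈ closedBall p.1 R ∧ p.2.2 ∈ closedBall p.1 R}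

/-- A morphism of (local) conical groups from `ℝ` to the tangent space at `x`, defined on the
neighbourhood `(-r, r)` of `0`. The group operation of the tangent space at `x` is
`Σ^x (u, v) = lim_{ε → 0} Σ_ε^x (u, v)`, and its dilatations are the `δ_ε^x`. -/
structure TangentMorphism (x : X) where
  toFun : ℝ → X
  r : ℝ
  r_pos : 0 < r
  mem_closedBall : ∀ s ∈ Ioo (-r) r, toFun s ∈ closedBall x D.A
  map_add : ∀ s ∈ Ioo (-r) r, ∀ t ∈ Ioo (-r) r, s + t ∈ Ioo (-r) r →
    Tendsto (fun ε => D.approxSum ε x (toFun s) (toFun t)) (𝓝[>] 0) (𝓝 (toFun (s + t)))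
  map_dil : ∀ ε > 0, ∀ s ∈ Ioo (-r) r, ε * s ∈ Ioo (-r) r → toFun (ε * s) = D.δ ε x (toFun s)

/-- The constant morphism. -/
instance (x : X) : Inhabited (D.TangentMorphism x) where
  default :=
    { toFun := fun _ => x
      r := 1
      r_pos := one_pos
      mem_closedBall := fun _ _ => mem_closedBall_self (zero_le_one.trans D.one_lt_A.le)
      map_add := by
        intro s _ t _ _
        refine tendsto_const_nhds.congr' ?_
        filter_upwards [self_mem_nhdsWithin] with ε hε
        simp only [mem_Ioi] at hε
        simp [approxSum, D.A1_base x ε hε, D.A1_base x ε⁻¹ (inv_pos.2 hε)]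
      map_dil := fun ε hε _ _ _ => (D.A1_base x ε hε).symm }

/-- The value `d^x (x, f 1)`, where `f` is a morphism from `ℝ` to the tangent space at `x`.
Since `f` is only given on the neighbourhood `(-r, r)` of `0`, the vector `f 1` is in general the
vector `f s`, for a small `s > 0`, dilated by `1 / s` in the tangent cone, and `d^x` is
homogeneous with respect to dilatations: `d^x (x, f 1) = d^x (x, f s) / s`. Here `s = r / 2`. -/
noncomputable def TangentMorphism.norm {D : DilatationStructure X} {x : X}
    (f : D.TangentMorphism x) : ℝ :=
  D.dx x x (f.toFun (f.r / 2)) / (f.r / 2)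

/-- The morphism `f` is a derivative at `t` of the curve `c`. -/
def HasDerivative (c : ℝ → X) (t : ℝ) (f : D.TangentMorphism (c t)) : Prop :=
  ∀ s ∈ Ioo (-f.r) f.r,
    Tendsto (fun ε => ε⁻¹ * dist (c (t + ε * s)) (D.δ ε (c t) (f.toFun s))) (𝓝[>] 0) (𝓝 0)

/-- The curve `c` is derivable at `t`. -/
def DerivableAt (c : ℝ → X) (t : ℝ) : Prop :=
  ∃ f : D.TangentMorphism (c t), D.HasDerivative c t f

open Classical in
/-- The derivative of `c` at `t` (the constant morphism if `c` is not derivable at `t`). -/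
noncomputable def derivative (c : ℝ → X) (t : ℝ) : D.TangentMorphism (c t) :=
  if h : D.DerivableAt c t then h.choose else default

/-- The number `d^{c(t)} (c(t), c'(t))`. -/
noncomputable def speed (c : ℝ → X) (t : ℝ) : ℝ := (D.derivative c t).norm

/-- The Radon-Nikodym property: Lipschitz curves are derivable almost everywhere. -/
def RadonNikodym : Prop :=
  ∀ (a b : ℝ) (c : ℝ → X), a ≤ b → IsLipCurve c a b →
    ∀ᵐ t ∂(volume.restrict (Icc a b)), D.DerivableAt c t

end DilatationStructure

/-!
Along a Lipschitz curve `c`, the tangent norm of the velocity is nothing but the *right metric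
derivative* `lim_{h → 0⁺} d (c t, c (t + h)) / h`: by the definition of derivability, `c (t + ε s)`
may be replaced by `δ_ε (f s)` up to `o(ε)`, and axiom A3, applied at the single base point `c t`,
identifies the limit of `d (c t, δ_ε (f s)) / ε` with `d^{c t} (c t, f s)`
(`DilatationStructure.DerivableAt.hasRightSpeed`).

The rest is metric geometry. The right metric derivative of a `K`-Lipschitz curve is measurable, as
an almost everywhere limit of continuous functions, and bounded by `K`, hence integrable
(`intervalIntegrable_of_hasRightSpeed`). It dominates the derivative of the Lipschitz function
`t ↦ d (c a, c t)`, so its integral is at least the distance of the end points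
(`dist_le_integral_of_hasRightSpeed`). It is dominated by the derivative of the variation of `c`
on `[a, t]`, a monotone function of `t`, so its integral is at most the length of `c`
(`integral_le_eVariationOn_of_hasRightSpeed`). In a length metric space, where the infimum of the
lengths is the distance, the infimum of the integrals is caught in between.
-/

/-- The curve `c` has right metric derivative `l` at `t`. -/
def HasRightSpeed {X : Type*} [MetricSpace X] (c : ℝ → X) (t l : ℝ) : Prop :=
  Tendsto (fun h => h⁻¹ * dist (c t) (c (t + h))) (𝓝[>] 0) (𝓝 l)

theorem eventually_add_mem_Ioo {a b t : ℝ} (ht : t ∈ Ioo a b) :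
    ∀ᶠ h : ℝ in 𝓝[>] 0, 0 < h ∧ t + h ∈ Ioo a b := by
  filter_upwards [Ioo_mem_nhdsGT (sub_pos.2 ht.2)] with h hh
  exact ⟨hh.1, by linarith [ht.1, hh.1], by linarith [hh.2]⟩

theorem HasDerivAt.tendsto_right_slope {φ : ℝ → ℝ} {φ' t : ℝ} (h : HasDerivAt φ φ' t) :
    Tendsto (fun h => h⁻¹ * (φ (t + h) - φ t)) (𝓝[>] 0) (𝓝 φ') := by
  simpa using h.tendsto_slope_zero_right

theorem ae_differentiableAt_of_lipschitzOnWith {φ : ℝ → ℝ} {K : ℝ≥0} {a b : ℝ}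
    (hφ : LipschitzOnWith K φ (Icc a b)) :
    ∀ᵐ t ∂(volume.restrict (Ioo a b)), DifferentiableAt ℝ φ t := by
  rw [ae_restrict_iff' measurableSet_Ioo]
  filter_upwards [hφ.ae_differentiableWithinAt_of_mem_real] with t ht hab
  exact (ht (Ioo_subset_Icc_self hab)).differentiableAt (Icc_mem_nhds hab.1 hab.2)

section RightSpeed

variable {X : Type*} [MetricSpace X] {c : ℝ → X} {m : ℝ → ℝ} {K : ℝ≥0} {a b : ℝ}

theorem HasRightSpeed.nonneg {t l : ℝ} (h : HasRightSpeed c t l) : 0 ≤ l := by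
  refine ge_of_tendsto h ?_
  filter_upwards [self_mem_nhdsWithin] with ε hε
  exact mul_nonneg (inv_nonneg.2 (le_of_lt hε)) dist_nonneg

theorem HasRightSpeed.le_of_lipschitzOnWith {t l : ℝ} (h : HasRightSpeed c t l)
    (hc : LipschitzOnWith K c (Icc a b)) (ht : t ∈ Ioo a b) : l ≤ K := by
  refine le_of_tendsto h ?_
  filter_upwards [eventually_add_mem_Ioo ht] with ε hε
  have := hc.dist_le_mul _ (Ioo_subset_Icc_self ht) _ (Ioo_subset_Icc_self hε.2)
  rw [dist_self_add_right, Real.norm_of_nonneg hε.1.le] at this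
  rwa [inv_mul_le_iff₀ hε.1, mul_comm]

theorem intervalIntegrable_of_hasRightSpeed (hab : a ≤ b) (hc : LipschitzOnWith K c (Icc a b))
    (hm : ∀ᵐ t ∂(volume.restrict (Ioo a b)), HasRightSpeed c t (m t)) :
    IntervalIntegrable m volume a b := by
  rw [intervalIntegrable_iff_integrableOn_Ioo_of_le hab]
  have hmem : ∀ᵐ t ∂(volume.restrict (Ioo a b)), t ∈ Ioo a b :=
    ae_restrict_mem measurableSet_Ioo
  -- The values of `c` outside `[a, b]` are arbitrary, so the difference quotients are formed with
  -- the continuous extension of `c` that is constant on each side of the interval.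
  set g : ℝ → X := IccExtend hab ((Icc a b).domRestrict c) with hg
  have hgc : Continuous g := hc.continuousOn.domRestrict.Icc_extend'
  have hgeq : ∀ t ∈ Icc a b, g t = c t := fun t ht => by
    rw [hg, IccExtend_of_mem _ _ ht]; rfl
  have hlim : Tendsto (fun n : ℕ => 1 / ((n : ℝ) + 1)) atTop (𝓝[>] 0) :=
    tendsto_nhdsWithin_iff.2 ⟨tendsto_one_div_add_atTop_nhds_zero_nat,
      Eventually.of_forall fun n => mem_Ioi.2 Nat.one_div_pos_of_nat⟩
  have hmeas : AEStronglyMeasurable m (volume.restrict (Ioo a b)) := by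
    refine aestronglyMeasurable_of_tendsto_ae atTop
      (f := fun (n : ℕ) t => (1 / ((n : ℝ) + 1))⁻¹ * dist (g t) (g (t + 1 / ((n : ℝ) + 1))))
      (fun n => (by fun_prop : Continuous _).aestronglyMeasurable) ?_
    filter_upwards [hm, hmem] with t ht htab
    refine (ht.comp hlim).congr' ?_
    filter_upwards [hlim.eventually (eventually_add_mem_Ioo htab)] with n hn
    simp only [Function.comp_apply]
    rw [hgeq _ (Ioo_subset_Icc_self htab), hgeq _ (Ioo_subset_Icc_self hn.2)]
  refine Integrable.of_bound hmeas K ?_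
  filter_upwards [hm, hmem] with t ht htab
  rw [Real.norm_of_nonneg ht.nonneg]
  exact ht.le_of_lipschitzOnWith hc htab

theorem dist_le_integral_of_hasRightSpeed (hab : a ≤ b) (hc : LipschitzOnWith K c (Icc a b))
    (hm : ∀ᵐ t ∂(volume.restrict (Ioo a b)), HasRightSpeed c t (m t)) :
    dist (c a) (c b) ≤ ∫ t in a..b, m t := by
  have hφ : LipschitzOnWith (1 * K) (fun t => dist (c a) (c t)) (Icc a b) :=
    (LipschitzWith.dist_right (c a)).comp_lipschitzOnWith hc
  have hac : AbsolutelyContinuousOnInterval (fun t => dist (c a) (c t)) a b :=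
    LipschitzOnWith.absolutelyContinuousOnInterval (by rwa [uIcc_of_le hab])
  calc dist (c a) (c b) = ∫ t in a..b, deriv (fun t => dist (c a) (c t)) t := by
        rw [hac.integral_deriv_eq_sub, dist_self, sub_zero]
    _ ≤ ∫ t in a..b, m t := by
        refine intervalIntegral.integral_mono_ae_restrict hab hac.intervalIntegrable_deriv
          (intervalIntegrable_of_hasRightSpeed hab hc hm) ?_
        rw [← restrict_Ioo_eq_restrict_Icc]
        filter_upwards [hm, ae_differentiableAt_of_lipschitzOnWith hφ] with t ht hd
        refine le_of_tendsto_of_tendsto hd.hasDerivAt.tendsto_right_slope ht ?_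
        filter_upwards [self_mem_nhdsWithin] with ε hε
        refine mul_le_mul_of_nonneg_left ?_ (inv_nonneg.2 (le_of_lt hε))
        linarith [dist_triangle (c a) (c t) (c (t + ε))]

theorem integral_le_eVariationOn_of_hasRightSpeed (hab : a ≤ b)
    (hc : LipschitzOnWith K c (Icc a b))
    (hm : ∀ᵐ t ∂(volume.restrict (Ioo a b)), HasRightSpeed c t (m t)) :
    ∫ t in a..b, m t ≤ (eVariationOn c (Icc a b)).toReal := by
  have hbv : LocallyBoundedVariationOn c (Icc a b) := hc.locallyBoundedVariationOn
  have ha : a ∈ Icc a b := left_mem_Icc.2 hab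
  have hb : b ∈ Icc a b := right_mem_Icc.2 hab
  set v : ℝ → ℝ := variationOnFromTo c (Icc a b) a with hv
  have hmono : MonotoneOn v (Icc a b) := variationOnFromTo.monotoneOn hbv ha
  have hmono' : MonotoneOn v (uIcc a b) := by rwa [uIcc_of_le hab]
  have hdist : ∀ s ∈ Icc a b, ∀ t ∈ Icc a b, s ≤ t → dist (c s) (c t) ≤ v t - v s := by
    intro s hs t ht hst
    rw [hv, variationOnFromTo.sub_right hbv ha ht hs, variationOnFromTo.eq_of_le _ _ hst]
    have hfin : BoundedVariationOn c (Icc a b ∩ Icc s t) := hbv s t hs ht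
    exact hfin.dist_le ⟨hs, left_mem_Icc.2 hst⟩ ⟨ht, right_mem_Icc.2 hst⟩
  have hdiff : ∀ᵐ t ∂(volume.restrict (Ioo a b)), DifferentiableAt ℝ v t := by
    rw [ae_restrict_iff' measurableSet_Ioo]
    filter_upwards [hmono.ae_differentiableWithinAt_of_mem] with t ht htab
    exact (ht (Ioo_subset_Icc_self htab)).differentiableAt (Icc_mem_nhds htab.1 htab.2)
  calc ∫ t in a..b, m t ≤ ∫ t in a..b, deriv v t := by
        refine intervalIntegral.integral_mono_ae_restrict hab
          (intervalIntegrable_of_hasRightSpeed hab hc hm) hmono'.intervalIntegrable_deriv ?_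
        rw [← restrict_Ioo_eq_restrict_Icc]
        filter_upwards [hm, hdiff, ae_restrict_mem measurableSet_Ioo] with t ht hd htab
        refine le_of_tendsto_of_tendsto ht hd.hasDerivAt.tendsto_right_slope ?_
        filter_upwards [eventually_add_mem_Ioo htab] with ε hε
        exact mul_le_mul_of_nonneg_left (hdist _ (Ioo_subset_Icc_self htab) _
          (Ioo_subset_Icc_self hε.2) (by linarith [hε.1])) (inv_nonneg.2 hε.1.le)
    _ ≤ v b - v a := by
        have h := hmono'.intervalIntegral_deriv_mem_uIcc
        rw [uIcc_of_le (sub_nonneg.2 (hmono ha hb hab))] at h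
        exact h.2
    _ = (eVariationOn c (Icc a b)).toReal := by
        rw [hv, variationOnFromTo.self, sub_zero, variationOnFromTo.eq_of_le _ _ hab, inter_self]

end RightSpeed

namespace DilatationStructure

variable {X : Type*} [MetricSpace X] (D : DilatationStructure X)

theorem tendsto_dist_dilatation (x : X) {u : X} (hu : u ∈ closedBall x D.A) :
    Tendsto (fun ε => ε⁻¹ * dist x (D.δ ε x u)) (𝓝[>] 0) (𝓝 (D.dx x x u)) := by
  rw [Metric.tendsto_nhds]
  intro η hη
  obtain ⟨ε₀, hε₀, h⟩ := D.A3_lim {x} isCompact_singleton (η / 2) (half_pos hη)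
  filter_upwards [Ioo_mem_nhdsGT hε₀] with ε hε
  have hxu := h ε hε x rfl x (mem_closedBall_self (zero_le_one.trans D.one_lt_A.le)) u hu
  rw [D.A1_base x ε hε.1] at hxu
  exact (Real.dist_eq _ _).trans_lt (hxu.trans_lt (half_lt_self hη))

variable {D}

theorem HasDerivative.hasRightSpeed {c : ℝ → X} {t : ℝ} {f : D.TangentMorphism (c t)}
    (hf : D.HasDerivative c t f) : HasRightSpeed c t f.norm := by
  have hs : 0 < f.r / 2 := half_pos f.r_pos
  have hmem : f.r / 2 ∈ Ioo (-f.r) f.r := ⟨by linarith, by linarith⟩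
  have htan := D.tendsto_dist_dilatation (c t) (f.mem_closedBall _ hmem)
  have hcurve : Tendsto (fun ε => ε⁻¹ * dist (c t) (c (t + ε * (f.r / 2)))) (𝓝[>] 0)
      (𝓝 (D.dx (c t) (c t) (f.toFun (f.r / 2)))) := by
    have hzero := hf _ hmem
    refine tendsto_of_tendsto_of_tendsto_of_le_of_le' (by simpa using htan.sub hzero)
      (by simpa using htan.add hzero) ?_ ?_
    all_goals
      filter_upwards [self_mem_nhdsWithin] with ε hε
      have hε' : 0 ≤ ε⁻¹ := inv_nonneg.2 (le_of_lt hε)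
    · rw [← mul_sub]
      refine mul_le_mul_of_nonneg_left ?_ hε'
      linarith [dist_triangle (c t) (c (t + ε * (f.r / 2)))
        (D.δ ε (c t) (f.toFun (f.r / 2)))]
    · rw [← mul_add]
      refine mul_le_mul_of_nonneg_left ?_ hε'
      linarith [dist_triangle_right (c t) (c (t + ε * (f.r / 2)))
        (D.δ ε (c t) (f.toFun (f.r / 2)))]
  -- The increment `h` of the parameter is `ε * s` with `s = r / 2`, so that `ε = h / s`.
  have hscale : Tendsto (fun h : ℝ => h / (f.r / 2)) (𝓝[>] 0) (𝓝[>] 0) := by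
    refine tendsto_nhdsWithin_iff.2 ⟨?_, ?_⟩
    · exact ((continuous_id.div_const (f.r / 2)).tendsto' 0 0 (zero_div _)).mono_left
        nhdsWithin_le_nhds
    · filter_upwards [self_mem_nhdsWithin] with h hh using div_pos hh hs
  refine ((hcurve.comp hscale).div_const (f.r / 2)).congr fun h => ?_
  simp only [Function.comp_apply]
  rw [div_mul_cancel₀ _ hs.ne', inv_div]
  have hr := f.r_pos.ne'
  field_simp

theorem DerivableAt.hasRightSpeed {c : ℝ → X} {t : ℝ} (h : D.DerivableAt c t) :
    HasRightSpeed c t (D.speed c t) := by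
  have hd : D.HasDerivative c t (D.derivative c t) := by
    rw [derivative, dif_pos h]
    exact h.choose_spec
  exact hd.hasRightSpeed

theorem RadonNikodym.ae_hasRightSpeed (hRN : D.RadonNikodym) {a b : ℝ} {c : ℝ → X} (hab : a ≤ b)
    (hc : IsLipCurve c a b) :
    ∀ᵐ t ∂(volume.restrict (Ioo a b)), HasRightSpeed c t (D.speed c t) := by
  filter_upwards [ae_restrict_of_ae_restrict_of_subset Ioo_subset_Icc_self (hRN a b c hab hc)]
    with t ht using ht.hasRightSpeed

end DilatationStructure

theorem theorem35 {X : Type*} [MetricSpace X] [CompleteSpace X] (D : DilatationStructure X)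
    (hstrong : D.IsStrong) (hRN : D.RadonNikodym) (hlength : IsLengthMetricSpace X) :
    (∀ (a b : ℝ) (c : ℝ → X), a ≤ b → IsLipCurve c a b →
      IntervalIntegrable (fun t => D.speed c t) volume a b) ∧
    ∀ x y : X, IsGLB {I : ℝ | ∃ (a b : ℝ) (c : ℝ → X), a ≤ b ∧ IsLipCurve c a b ∧
      c a = x ∧ c b = y ∧ I = ∫ t in a..b, D.speed c t} (dist x y) := by
  refine ⟨fun a b c hab hc => ?_, fun x y => ⟨?_, fun L hL => ?_⟩⟩
  · obtain ⟨K, hK⟩ := hc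
    exact intervalIntegrable_of_hasRightSpeed hab hK (hRN.ae_hasRightSpeed hab ⟨K, hK⟩)
  · rintro I ⟨a, b, c, hab, ⟨K, hK⟩, rfl, rfl, rfl⟩
    exact dist_le_integral_of_hasRightSpeed hab hK (hRN.ae_hasRightSpeed hab ⟨K, hK⟩)
  · suffices h : ENNReal.ofReal L ≤ edist x y by
      rwa [edist_dist, ENNReal.ofReal_le_ofReal_iff dist_nonneg] at h
    refine (hlength x y).2 ?_
    rintro l ⟨a, b, c, hab, ⟨K, hK⟩, hx, hy, rfl⟩
    have hLI := hL ⟨a, b, c, hab, ⟨K, hK⟩, hx, hy, rfl⟩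
    exact ENNReal.ofReal_le_of_le_toReal (hLI.trans
      (integral_le_eVariationOn_of_hasRightSpeed hab hK (hRN.ae_hasRightSpeed hab ⟨K, hK⟩)))
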